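/- Let $X$ be a compact metric space, $C:X\times X\to\mathbb{R}$ a continuous symmetric cost and $\varepsilon>0$. Let $\varphi:[0,\infty)\to[0,\infty]$ be any entropy function, i.e. convex, lower semicontinuous, with $\varphi(1)=0$; put $\varphi'_\infty=\lim_{p\to\infty}\varphi(p)/p$ and $\varphi^*(q)=\sup_{p\ge 0}\,(pq-\varphi(p))$. For finite positive Borel measures $\mu,\nu$ with Lebesgue decomposition $\mu=\frac{d\mu}{d\nu}\nu+\mu^\perp$, let $D_\varphi(\mu|\nu)=\int\varphi\big(\frac{d\mu}{d\nu}\big)\,d\nu+\varphi'_\infty\,\mu^\perp$(total space), with $\infty\cdot 0=0$, and let $\mathrm{KL}=D_{p\log p-p+1}$. For finite positive Borel measures $\alpha,\beta$ on $X$, with total masses $m(\alpha),m(\beta)$, define $$\mathrm{OT}_\varepsilon(\alpha,\beta)=\inf_{\pi}\ \int C\,d\pi+D_\varphi(\pi_1|\alpha)+D_\varphi(\pi_2|\beta)+\varepsilon\,\mathrm{KL}(\pi|\alpha\otimes\beta),$$ where $\pi$ ranges over the finite positive Borel measures on $X\times X$ and $\pi_1,\pi_2$ are its marginals, $$S_\varepsilon(\alpha,\beta)=\mathrm{OT}_\varepsilon(\alpha,\beta)-\tfrac12\mathrm{OT}_\varepsilon(\alpha,\alpha)-\tfrac12\mathrm{OT}_\varepsilon(\beta,\beta)+\tfrac{\varepsilon}{2}\big(m(\alpha)-m(\beta)\big)^2,$$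 $$F_\varepsilon(\alpha)=-\sup_{f\in\mathcal{C}(X)}\ \Big(-\int\varphi^*(-f)\,d\alpha-\tfrac{\varepsilon}{2}\iint e^{(f(x)+f(y)-C(x,y))/\varepsilon}\,d\alpha(x)\,d\alpha(y)\Big).$$ An optimal symmetric potential for $F_\varepsilon(\alpha)$ is a function in $\mathcal{C}(X)$ that attains this supremum. For a finite signed measure $\nu$ on $X$ write $\|\nu\|^2_{k_\varepsilon}=\iint k_\varepsilon(x,y)\,d\nu(x)\,d\nu(y)$ with $k_\varepsilon=e^{-C/\varepsilon}$. Let $f_\alpha$ and $g_\beta$ be optimal symmetric potentials for $F_\varepsilon(\alpha)$ and $F_\varepsilon(\beta)$ respectively. Then $\mathrm{OT}_\varepsilon(\alpha,\alpha)$ and $\mathrm{OT}_\varepsilon(\beta,\beta)$ are finite and $\mathrm{OT}_\varepsilon(\alpha,\beta)>-\infty$, so that $S_\varepsilon(\alpha,\beta)\in(-\infty,+\infty]$ is well defined, and $$S_\varepsilon(\alpha,\beta)\ \ge\ \tfrac{\varepsilon}{2}\,\big\|\,\alpha e^{f_\alpha/\varepsilon}-\beta e^{g_\beta/\varepsilon}\,\big\|^2_{k_\varepsilon}.$$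 -/

import Mathlib

open MeasureTheory Filter Topology
open scoped ENNReal NNReal

namespace Sinkhorn

/-- An entropy function: a convex, lower semicontinuous `φ : [0, ∞) → [0, ∞]` with `φ 1 = 0`. -/
structure IsEntropy (φ : ℝ≥0 → ℝ≥0∞) : Prop where
  convex : ConvexOn ℝ≥0 Set.univ φ
  lsc : LowerSemicontinuous φ
  map_one : φ 1 = 0

/-- The recession constant `φ'_∞ = lim_{p → ∞} φ p / p`. It is written as a `limsup`; for an entropy
function it is an actual limit, see `IsEntropy.tendsto_recession`. -/
noncomputable def recession (φ : ℝ≥0 → ℝ≥0∞) : ℝ≥0∞ :=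
  limsup (fun p : ℝ≥0 => φ p / (p : ℝ≥0∞)) atTop

theorem IsEntropy.div_le_div {φ : ℝ≥0 → ℝ≥0∞} (hφ : IsEntropy φ) {p q : ℝ≥0} (hp : 1 ≤ p)
    (hpq : p ≤ q) : φ p / (p : ℝ≥0∞) ≤ φ q / (q : ℝ≥0∞) := by
  rcases eq_or_lt_of_le hpq with rfl | hlt
  · exact le_rfl
  have hp0 : 0 < p := lt_of_lt_of_le one_pos hp
  have hq0 : 0 < q := hp0.trans hlt
  have hle : φ p ≤ ((p / q : ℝ≥0) : ℝ≥0∞) * φ q := by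
    have hq1 : 1 < q := lt_of_le_of_lt hp hlt
    obtain ⟨a, rfl⟩ : ∃ a, p = 1 + a := ⟨p - 1, (add_tsub_cancel_of_le hp).symm⟩
    obtain ⟨b, rfl⟩ : ∃ b, q = 1 + a + b := ⟨q - (1 + a), (add_tsub_cancel_of_le hpq).symm⟩
    have hab : 0 < a + b := by
      have : 0 < (a : ℝ) + b := by
        have : (1 : ℝ) < 1 + a + b := by exact_mod_cast hq1
        linarith
      exact_mod_cast this
    have hne : a + b ≠ 0 := hab.ne'
    have h1 : b / (a + b) + a / (a + b) = 1 := by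
      field_simp
      ring
    have key := hφ.convex.2 (Set.mem_univ (1 : ℝ≥0)) (Set.mem_univ (1 + a + b))
      (zero_le (a := b / (a + b))) (zero_le (a := a / (a + b))) h1
    have h2 : (b / (a + b)) • (1 : ℝ≥0) + (a / (a + b)) • (1 + a + b) = 1 + a := by
      simp only [smul_eq_mul]
      field_simp
      ring
    rw [h2, hφ.map_one, smul_zero, zero_add] at key
    refine key.trans ?_
    change ((a / (a + b) : ℝ≥0) : ℝ≥0∞) * _ ≤ _
    refine mul_le_mul' (ENNReal.coe_le_coe.2 ?_) le_rfl
    rw [div_le_div_iff₀ hab hq0, ← NNReal.coe_le_coe]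
    push_cast
    nlinarith [a.coe_nonneg, b.coe_nonneg]
  calc φ p / (p : ℝ≥0∞) ≤ ((p / q : ℝ≥0) : ℝ≥0∞) * φ q / p := by gcongr
    _ = φ q / (q : ℝ≥0∞) := by
      rw [ENNReal.coe_div hq0.ne', div_eq_mul_inv, div_eq_mul_inv, div_eq_mul_inv,
        mul_comm, mul_assoc, ← mul_assoc, ← mul_assoc,
        ENNReal.inv_mul_cancel (by exact_mod_cast hp0.ne') ENNReal.coe_ne_top, one_mul, mul_comm]

theorem IsEntropy.tendsto_recession {φ : ℝ≥0 → ℝ≥0∞} (hφ : IsEntropy φ) :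
    Tendsto (fun p : ℝ≥0 => φ p / (p : ℝ≥0∞)) atTop (𝓝 (recession φ)) := by
  have hmono : Monotone fun p : ℝ≥0 => φ (max 1 p) / ((max 1 p : ℝ≥0) : ℝ≥0∞) :=
    fun p q hpq => hφ.div_le_div (le_max_left 1 p) (max_le_max le_rfl hpq)
  have h : Tendsto (fun p : ℝ≥0 => φ p / (p : ℝ≥0∞)) atTop
      (𝓝 (⨆ p : ℝ≥0, φ (max 1 p) / ((max 1 p : ℝ≥0) : ℝ≥0∞))) := by
    refine (tendsto_atTop_iSup hmono).congr' ?_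
    filter_upwards [eventually_ge_atTop 1] with p hp
    rw [max_eq_right hp]
  rw [recession, h.limsup_eq]
  exact h

/-- The Legendre conjugate `φ* q = sup_{p ≥ 0} (p q - φ p)`, with values in `[-∞, ∞]`. -/
noncomputable def conjugate (φ : ℝ≥0 → ℝ≥0∞) (q : ℝ) : EReal :=
  ⨆ p : ℝ≥0, (((p : ℝ) * q : ℝ) : EReal) - ((φ p : ℝ≥0∞) : EReal)

/-- The integral of an extended-real-valued function, positive part minus negative part. -/
noncomputable def integralEReal {X : Type*} [MeasurableSpace X] (μ : Measure X) (h : X → EReal) :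
    EReal :=
  ((∫⁻ x, (h x).toENNReal ∂μ : ℝ≥0∞) : EReal) - ((∫⁻ x, (-h x).toENNReal ∂μ : ℝ≥0∞) : EReal)

/-- The `φ`-divergence `D_φ(μ|ν) = ∫ φ(dμ/dν) dν + φ'_∞ μ^⊥(X)`, where `μ = (dμ/dν) ν + μ^⊥` is the
Lebesgue decomposition (with the convention `∞ * 0 = 0`). -/
noncomputable def csiszarDiv {X : Type*} [MeasurableSpace X] (φ : ℝ≥0 → ℝ≥0∞) (μ ν : Measure X) :
    ℝ≥0∞ :=
  ∫⁻ x, φ (μ.rnDeriv ν x).toNNReal ∂ν + recession φ * μ.singularPart ν Set.univ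

/-- The regularized unbalanced transport cost `OT_ε(α, β)`: the infimum over all finite positive
measures `π` on `X × X` of
`∫ C dπ + D_φ(π₁|α) + D_φ(π₂|β) + ε KL(π|α ⊗ β)`.
Mathlib's `klDiv π ν` is `∫ log(dπ/dν) dπ - π(X × X) + ν(X × X)` for `π ≪ ν`, and `∞` otherwise. -/
noncomputable def OT {X : Type*} [MeasurableSpace X] (φ : ℝ≥0 → ℝ≥0∞) (C : X → X → ℝ) (ε : ℝ)
    (α β : Measure X) : EReal :=
  ⨅ π : FiniteMeasure (X × X),
    ((∫ z, C z.1 z.2 ∂(π : Measure (X × X)) : ℝ) : EReal) +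
      ((csiszarDiv φ (π : Measure (X × X)).fst α + csiszarDiv φ (π : Measure (X × X)).snd β +
        ENNReal.ofReal ε * InformationTheory.klDiv (π : Measure (X × X)) (α.prod β) : ℝ≥0∞) : EReal)

/-- The Sinkhorn divergence
`S_ε(α, β) = OT_ε(α, β) - OT_ε(α, α) / 2 - OT_ε(β, β) / 2 + (ε / 2) (m(α) - m(β))²`. -/
noncomputable def sinkhornDiv {X : Type*} [MeasurableSpace X] (φ : ℝ≥0 → ℝ≥0∞) (C : X → X → ℝ)
    (ε : ℝ) (α β : Measure X) : EReal :=
  OT φ C ε α β - ((1 / 2 : ℝ) : EReal) * OT φ C ε α α - ((1 / 2 : ℝ) : EReal) * OT φ C ε β β +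
    ((ε / 2 * (α.real Set.univ - β.real Set.univ) ^ 2 : ℝ) : EReal)

/-- The symmetric dual functional
`f ↦ -∫ φ*(-f) dα - (ε / 2) ∬ exp((f(x) + f(y) - C(x, y)) / ε) dα(x) dα(y)`. -/
noncomputable def symDual {X : Type*} [TopologicalSpace X] [MeasurableSpace X]
    (φ : ℝ≥0 → ℝ≥0∞) (C : X → X → ℝ) (ε : ℝ) (α : Measure X) (f : C(X, ℝ)) : EReal :=
  -integralEReal α (fun x => conjugate φ (-f x)) -
    ((ε / 2 * ∫ z, Real.exp ((f z.1 + f z.2 - C z.1 z.2) / ε) ∂(α.prod α) : ℝ) : EReal)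

/-- The Sinkhorn entropy `F_ε(α)`, minus the supremum of the symmetric dual functional over all
continuous functions. -/
noncomputable def sinkhornEntropy {X : Type*} [TopologicalSpace X] [MeasurableSpace X]
    (φ : ℝ≥0 → ℝ≥0∞) (C : X → X → ℝ) (ε : ℝ) (α : Measure X) : EReal :=
  -⨆ f : C(X, ℝ), symDual φ C ε α f

/-- `f` is an optimal symmetric potential for `F_ε(α)`: it attains the supremum in the definition. -/
def IsOptimalPotential {X : Type*} [TopologicalSpace X] [MeasurableSpace X]
    (φ : ℝ≥0 → ℝ≥0∞) (C : X → X → ℝ) (ε : ℝ) (α : Measure X) (f : C(X, ℝ)) : Prop :=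
  -symDual φ C ε α f = sinkhornEntropy φ C ε α

/-- The Gibbs kernel `k_ε(x, y) = exp(-C(x, y) / ε)`. -/
noncomputable def gibbsKernel {X : Type*} (C : X → X → ℝ) (ε : ℝ) (x y : X) : ℝ :=
  Real.exp (-C x y / ε)

/-- The squared kernel norm `‖ν‖²_k = ∬ k(x, y) dν(x) dν(y)` of a signed measure `ν`. -/
noncomputable def kernelNormSq {X : Type*} [MeasurableSpace X] (k : X → X → ℝ)
    (ν : SignedMeasure X) : ℝ :=
  ∫ᵛ x, (∫ᵛ y, k x y ∂<•ν) ∂<•ν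

end Sinkhorn

/-! Bound `OT φ C ε α β` below by weak duality at the pair `(f, g)`, and bound the two self-costs
above by explicit primal plans. With `D` the plan density, this gives `OT(α,β) ≥ -∫φ*(-f)dα -
∫φ*(-g)dβ - ε∬D_fg + ε m(α)m(β)` and `OT(α,α) ≤ -2∫φ*(-f)dα - ε∬D_ff + ε m(α)²`, and likewise for
`β`. In the combination defining `sinkhornDiv` the conjugate terms cancel, the masses cancel against
`(ε/2)(m(α) - m(β))²`, and `(ε/2)(∬D_ff - 2∬D_fg + ∬D_gg)` remains, which is the kernel norm.
Neither positivity of the kernel nor an optimal dual pair for `(α, β)` enters.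

The upper bound (`IsOptimalPotential.OT_self_le`) is the substantial half. Since `φ` is arbitrary,
`φ*` need be neither finite nor differentiable, so the optimality condition cannot be read off a
derivative. Instead `f` is moved locally towards constants `s` with `φ*(-s)` finite, where convexity
controls `φ*`. The resulting one-sided inequalities (`IsOptimalPotential.integral_mul_nonneg`) hold
for every affine minorant of `φ`, and Fenchel–Moreau (`IsEntropy.exists_conjugate_le`) turns them
into equality in Fenchel–Young for the marginal density of the plan
(`IsOptimalPotential.ae_entropy_le`). -/

namespace Sinkhorn

/-! ### Convex duality for entropy functions on the half-line. -/

section Conjugate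

variable {φ : ℝ≥0 → ℝ≥0∞}

/-- Pairs `(q, c)` with `φ*(q) ≤ c` are exactly the affine minorants `p ↦ p q - c` of `φ`.
Truncating at zero costs nothing because `φ ≥ 0`. -/
theorem conjugate_le_coe_iff {q c : ℝ} :
    conjugate φ q ≤ (c : EReal) ↔ ∀ p : ℝ≥0, ENNReal.ofReal (p * q - c) ≤ φ p := by
  rw [conjugate, iSup_le_iff]
  refine forall_congr' fun p => ?_
  rcases eq_or_ne (φ p) ⊤ with h | h
  · simp [h]
  · lift φ p to ℝ≥0 using h with r
    rw [← EReal.coe_ennreal_toReal ENNReal.coe_ne_top, ← EReal.coe_sub, EReal.coe_le_coe_iff,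
      ENNReal.ofReal_le_iff_le_toReal ENNReal.coe_ne_top]
    constructor <;> intro h <;> linarith

theorem conjugate_mono : Monotone (conjugate φ) := by
  intro q q' h
  refine iSup_mono fun p => EReal.sub_le_sub ?_ le_rfl
  exact EReal.coe_le_coe_iff.2 (mul_le_mul_of_nonneg_left h p.coe_nonneg)

theorem measurable_conjugate : Measurable (conjugate φ) :=
  conjugate_mono.measurable

theorem conjugate_zero_le : conjugate φ 0 ≤ 0 := by
  have : conjugate φ 0 ≤ ((0 : ℝ) : EReal) := conjugate_le_coe_iff.2 (by simp)
  simpa using this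

theorem IsEntropy.le_conjugate (hφ : IsEntropy φ) (q : ℝ) : (q : EReal) ≤ conjugate φ q := by
  refine le_trans ?_ (le_iSup _ (1 : ℝ≥0))
  simp [hφ.map_one]

/-- A convex combination of two affine minorants lies below their maximum, hence below `φ`. Real
upper bounds avoid extended-real arithmetic. -/
theorem conjugate_convex_comb_le {q₀ q₁ c₀ c₁ t : ℝ} (h₀ : conjugate φ q₀ ≤ (c₀ : EReal))
    (h₁ : conjugate φ q₁ ≤ (c₁ : EReal)) (ht₀ : 0 ≤ t) (ht₁ : t ≤ 1) :
    conjugate φ ((1 - t) * q₀ + t * q₁) ≤ (((1 - t) * c₀ + t * c₁ : ℝ) : EReal) := by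
  rw [conjugate_le_coe_iff] at *
  intro p
  refine le_trans (ENNReal.ofReal_le_ofReal (q := max (p * q₀ - c₀) (p * q₁ - c₁)) ?_) ?_
  · have h2 := mul_le_mul_of_nonneg_left (le_max_left (p * q₀ - c₀) (p * q₁ - c₁))
      (sub_nonneg.2 ht₁)
    have h3 := mul_le_mul_of_nonneg_left (le_max_right (p * q₀ - c₀) (p * q₁ - c₁)) ht₀
    linarith
  · rw [ENNReal.ofReal_max]
    exact max_le (h₀ p) (h₁ p)

theorem exists_forall_le_and_forall_ge {S T : Set ℝ} (hS : BddAbove S) (hT : BddBelow T)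
    (h : ∀ s ∈ S, ∀ t ∈ T, s ≤ t) : ∃ q, (∀ s ∈ S, s ≤ q) ∧ ∀ t ∈ T, q ≤ t := by
  rcases S.eq_empty_or_nonempty with rfl | hne
  · obtain ⟨q, hq⟩ := hT
    exact ⟨q, by simp, hq⟩
  · exact ⟨sSup S, fun s hs => le_csSup hS hs, fun t ht => csSup_le hne fun s hs => h s hs t ht⟩

/-- Three-chord inequality with the middle value lowered to `c`, so that `φ p = ∞` is allowed. -/
theorem IsEntropy.slope_le_slope_of_lt (hφ : IsEntropy φ) {c : ℝ} {p r s : ℝ≥0}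
    (hc : ENNReal.ofReal c < φ p) (hr : r < p) (hs : p < s) (hr' : φ r ≠ ⊤) (hs' : φ s ≠ ⊤) :
    (c - (φ r).toReal) / (p - r) ≤ ((φ s).toReal - c) / (s - p) := by
  obtain ⟨a, ha, rfl⟩ : ∃ a, 0 < a ∧ p = r + a :=
    ⟨p - r, tsub_pos_of_lt hr, (add_tsub_cancel_of_le hr.le).symm⟩
  obtain ⟨b, hb, rfl⟩ : ∃ b, 0 < b ∧ s = r + a + b :=
    ⟨s - (r + a), tsub_pos_of_lt hs, (add_tsub_cancel_of_le hs.le).symm⟩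
  have hab : 0 < a + b := add_pos ha hb
  have h1 : b / (a + b) + a / (a + b) = 1 := by
    field_simp
    ring
  have key := hφ.convex.2 (Set.mem_univ r) (Set.mem_univ (r + a + b))
    (zero_le (a := b / (a + b))) (zero_le (a := a / (a + b))) h1
  have h2 : (b / (a + b)) • r + (a / (a + b)) • (r + a + b) = r + a := by
    simp only [smul_eq_mul]
    field_simp
    ring
  rw [h2] at key
  have hlt := hc.trans_le key
  lift φ r to ℝ≥0 using hr' with x
  lift φ (r + a + b) to ℝ≥0 using hs' with y
  have h3 : (b / (a + b)) • (x : ℝ≥0∞) + (a / (a + b)) • (y : ℝ≥0∞)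
      = ((b / (a + b) * x + a / (a + b) * y : ℝ≥0) : ℝ≥0∞) := by
    push_cast
    rfl
  rw [h3, ← ENNReal.ofReal_coe_nnreal] at hlt
  have hlt := (ENNReal.ofReal_lt_ofReal_iff'.1 hlt).1
  push_cast at hlt ⊢
  have ha' : (0 : ℝ) < a := ha
  have hb' : (0 : ℝ) < b := hb
  have e1 : (b : ℝ) / (a + b) * x + a / (a + b) * y = (b * x + a * y) / (a + b) := by ring
  rw [e1, lt_div_iff₀ (by positivity)] at hlt
  rw [add_sub_cancel_left, add_sub_cancel_left, div_le_div_iff₀ ha' hb', ENNReal.coe_toReal,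
    ENNReal.coe_toReal]
  linarith

/-- Fenchel–Moreau on the half-line: every value below `φ p` is attained at `p` by an affine
minorant of `φ`. -/
theorem IsEntropy.exists_conjugate_le (hφ : IsEntropy φ) {c : ℝ} {p : ℝ≥0}
    (hc : (c : EReal) < (φ p : EReal)) : ∃ q : ℝ, conjugate φ q ≤ ((p * q - c : ℝ) : EReal) := by
  simp only [conjugate_le_coe_iff]
  rcases lt_or_ge c 0 with hc0 | hc0
  · exact ⟨0, fun r => by simp [ENNReal.ofReal_of_nonpos hc0.le]⟩
  have hc' : ENNReal.ofReal c < φ p := by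
    rwa [← EReal.coe_ennreal_lt_coe_ennreal_iff, EReal.coe_ennreal_ofReal, max_eq_left hc0]
  -- Within `δ` of `p`, `φ` exceeds `c`, so slopes through `(p, c)` have the right sign. Farther
  -- away they are bounded by `c / δ` because `φ ≥ 0`. These bounds produce a slope even when `p`
  -- has no points of the domain of `φ` on one side.
  obtain ⟨δ, hδ, hball⟩ := Metric.eventually_nhds_iff.1 (hφ.lsc p _ hc')
  have hv : ∀ r : ℝ≥0, dist r p < δ → φ r ≠ ⊤ → c ≤ (φ r).toReal := fun r hr hr' =>
    (ENNReal.ofReal_le_iff_le_toReal hr').1 (hball hr).le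
  let S : Set ℝ := {x | ∃ r : ℝ≥0, r < p ∧ φ r ≠ ⊤ ∧ x = (c - (φ r).toReal) / (p - r)}
  let T : Set ℝ := {x | ∃ s : ℝ≥0, p < s ∧ φ s ≠ ⊤ ∧ x = ((φ s).toReal - c) / (s - p)}
  have hSbdd : BddAbove S := by
    refine ⟨c / δ, ?_⟩
    rintro _ ⟨r, h, hr, rfl⟩
    have hpos : (0 : ℝ) < p - r := sub_pos.2 (NNReal.coe_lt_coe.2 h)
    rcases lt_or_ge (dist r p) δ with hd | hd
    · exact (div_nonpos_of_nonpos_of_nonneg (sub_nonpos.2 (hv r hd hr)) hpos.le).trans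
        (by positivity)
    · rw [NNReal.dist_eq, abs_sub_comm, abs_of_pos hpos] at hd
      exact div_le_div₀ hc0 (by linarith [ENNReal.toReal_nonneg (a := φ r)]) hδ hd
  have hTbdd : BddBelow T := by
    refine ⟨-(c / δ), ?_⟩
    rintro _ ⟨r, h, hr, rfl⟩
    have hpos : (0 : ℝ) < r - p := sub_pos.2 (NNReal.coe_lt_coe.2 h)
    rw [neg_le, ← neg_div, neg_sub]
    rcases lt_or_ge (dist r p) δ with hd | hd
    · exact (div_nonpos_of_nonpos_of_nonneg (sub_nonpos.2 (hv r hd hr)) hpos.le).trans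
        (by positivity)
    · rw [NNReal.dist_eq, abs_of_pos hpos] at hd
      exact div_le_div₀ hc0 (by linarith [ENNReal.toReal_nonneg (a := φ r)]) hδ hd
  have hST : ∀ s ∈ S, ∀ t ∈ T, s ≤ t := by
    rintro _ ⟨r, hr, hr', rfl⟩ _ ⟨s, hs, hs', rfl⟩
    exact hφ.slope_le_slope_of_lt hc' hr hs hr' hs'
  obtain ⟨q, hq₁, hq₂⟩ := exists_forall_le_and_forall_ge hSbdd hTbdd hST
  refine ⟨q, fun r => ?_⟩
  rcases eq_or_ne (φ r) ⊤ with hr | hr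
  · simp [hr]
  rw [ENNReal.ofReal_le_iff_le_toReal hr]
  rcases lt_trichotomy r p with h | rfl | h
  · have := hq₁ _ ⟨r, h, hr, rfl⟩
    rw [div_le_iff₀ (sub_pos.2 (NNReal.coe_lt_coe.2 h))] at this
    linarith
  · have := hv r (by simpa using hδ) hr
    linarith
  · have := hq₂ _ ⟨r, h, hr, rfl⟩
    rw [le_div_iff₀ (sub_pos.2 (NNReal.coe_lt_coe.2 h))] at this
    linarith

/-- If `-w - p f` dominates every affine minorant of `φ` with rational data evaluated at `p`, it
dominates `φ p`. -/
theorem IsEntropy.coe_le_of_forall_rat (hφ : IsEntropy φ) {p : ℝ≥0} {w f : ℝ}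
    (h : ∀ q c : ℚ, conjugate φ q ≤ ((c : ℝ) : EReal) → 0 ≤ c - w + p * (-q - f)) :
    (φ p : EReal) ≤ ((-w - p * f : ℝ) : EReal) := by
  by_contra! hlt
  obtain ⟨c, hc₁, hc₂⟩ := EReal.lt_iff_exists_real_btwn.1 hlt
  rw [EReal.coe_lt_coe_iff] at hc₁
  obtain ⟨q, hq⟩ := hφ.exists_conjugate_le hc₂
  set η := c + w + p * f with hη
  have hη0 : 0 < η := by linarith
  have hp : (0 : ℝ) < p + 1 := by positivity
  -- `q` is rounded down and the intercept up: `φ*` is monotone, so the rational pair is still a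
  -- minorant. The total loss at `p` is at most `3η/4 < η`.
  obtain ⟨q', hq'₁, hq'₂⟩ := exists_rat_btwn (sub_lt_self q (div_pos hη0 (mul_pos four_pos hp)))
  obtain ⟨c', hc'₁, hc'₂⟩ := exists_rat_btwn (lt_add_of_pos_right (p * q - c) (half_pos hη0))
  have h1 := h q' c' ((conjugate_mono hq'₂.le).trans
    (hq.trans (EReal.coe_le_coe_iff.2 hc'₁.le)))
  have h2 : p * (q - q') ≤ η / 4 := by
    have : q - q' ≤ η / (4 * (p + 1)) := by linarith
    calc p * (q - q') ≤ (p + 1) * (η / (4 * (p + 1))) := by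
          refine mul_le_mul (by linarith) this (by linarith) hp.le
      _ = η / 4 := by field_simp
  nlinarith

end Conjugate

/-! ### Integrals of extended-real functions. -/

section IntegralEReal

variable {X : Type*} [MeasurableSpace X] {μ : Measure X} {h : X → EReal}

theorem integralEReal_mono_ae {h' : X → EReal} (hle : h ≤ᵐ[μ] h') :
    integralEReal μ h ≤ integralEReal μ h' := by
  refine EReal.sub_le_sub ?_ ?_
  · refine EReal.coe_ennreal_le_coe_ennreal_iff.2 (lintegral_mono_ae ?_)
    filter_upwards [hle] with x hx using EReal.toENNReal_le_toENNReal hx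
  · refine EReal.coe_ennreal_le_coe_ennreal_iff.2 (lintegral_mono_ae ?_)
    filter_upwards [hle] with x hx using EReal.toENNReal_le_toENNReal (EReal.neg_le_neg_iff.2 hx)

theorem integralEReal_coe {v : X → ℝ} (hv : Integrable v μ) :
    integralEReal μ (fun x => (v x : EReal)) = ((∫ x, v x ∂μ : ℝ) : EReal) := by
  have h1 : ∫⁻ x, ENNReal.ofReal (v x) ∂μ ≠ ⊤ :=
    ((lintegral_ofReal_le_lintegral_enorm v).trans_lt hv.2).ne
  have h2 : ∫⁻ x, ENNReal.ofReal (-v x) ∂μ ≠ ⊤ :=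
    ((lintegral_ofReal_le_lintegral_enorm _).trans_lt hv.neg.2).ne
  rw [integral_eq_lintegral_pos_part_sub_lintegral_neg_part hv, EReal.coe_sub,
    EReal.coe_ennreal_toReal h1, EReal.coe_ennreal_toReal h2]
  rfl

theorem integralEReal_le_integral {v : X → ℝ} (hv : Integrable v μ)
    (hle : ∀ᵐ x ∂μ, h x ≤ (v x : EReal)) : integralEReal μ h ≤ ((∫ x, v x ∂μ : ℝ) : EReal) :=
  (integralEReal_mono_ae hle).trans_eq (integralEReal_coe hv)

/-- The lower bound makes the negative part integrable, so an integral other than `⊤` forces the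
positive part to be integrable too. -/
theorem ae_eq_toReal_of_integralEReal_ne_top [IsFiniteMeasure μ] (hh : Measurable h) {M : ℝ}
    (hM : ∀ x, (M : EReal) ≤ h x) (hne : integralEReal μ h ≠ ⊤) :
    (∀ᵐ x ∂μ, h x = ((h x).toReal : EReal)) ∧ Integrable (fun x => (h x).toReal) μ := by
  have hneg : ∀ x, (-h x).toENNReal ≤ ENNReal.ofReal (-M) := fun x => by
    rw [← EReal.real_coe_toENNReal, EReal.coe_neg]
    exact EReal.toENNReal_le_toENNReal (EReal.neg_le_neg_iff.2 (hM x))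
  have hnegfin : ∫⁻ x, (-h x).toENNReal ∂μ ≠ ⊤ :=
    ((lintegral_mono hneg).trans_lt (by
      rw [lintegral_const]
      exact ENNReal.mul_lt_top ENNReal.ofReal_lt_top (measure_lt_top μ _))).ne
  have hpos : ∫⁻ x, (h x).toENNReal ∂μ ≠ ⊤ := by
    intro htop
    apply hne
    rw [integralEReal, htop]
    lift ∫⁻ x, (-h x).toENNReal ∂μ to ℝ≥0 using hnegfin with r
    rw [← EReal.coe_ennreal_toReal ENNReal.coe_ne_top]
    simp
  have hbot : ∀ x, h x ≠ ⊥ := fun x => ((EReal.bot_lt_coe M).trans_le (hM x)).ne'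
  have hae : ∀ᵐ x ∂μ, h x ≠ ⊤ := by
    filter_upwards [ae_lt_top (by fun_prop) hpos] with x hx hx'
    simp [hx'] at hx
  refine ⟨?_, ?_⟩
  · filter_upwards [hae] with x hx using (EReal.coe_toReal hx (hbot x)).symm
  · refine ⟨hh.ereal_toReal.aestronglyMeasurable, ?_⟩
    have : ∀ᵐ x ∂μ, ‖(h x).toReal‖ₑ ≤ (h x).toENNReal + ENNReal.ofReal (-M) := by
      filter_upwards [hae] with x hx
      have hMx : M ≤ (h x).toReal := by
        rw [← EReal.coe_le_coe_iff, EReal.coe_toReal hx (hbot x)]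
        exact hM x
      rw [EReal.toENNReal_of_ne_top hx, Real.enorm_eq_ofReal_abs]
      rcases le_total 0 (h x).toReal with h0 | h0
      · rw [abs_of_nonneg h0]
        exact le_self_add
      · rw [abs_of_nonpos h0]
        exact (ENNReal.ofReal_le_ofReal (neg_le_neg hMx)).trans le_add_self
    refine (lintegral_mono_ae this).trans_lt ?_
    rw [lintegral_add_right _ measurable_const, lintegral_const]
    exact ENNReal.add_lt_top.2 ⟨hpos.lt_top, ENNReal.mul_lt_top ENNReal.ofReal_lt_top
      (measure_lt_top μ _)⟩

end IntegralEReal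

/-! ### First variation of the symmetric dual functional. -/

section FirstOrder

variable {X : Type*} [MetricSpace X] [CompactSpace X] [MeasurableSpace X] [BorelSpace X]
  {φ : ℝ≥0 → ℝ≥0∞} {C : X → X → ℝ} {ε : ℝ} {α β : Measure X} [IsFiniteMeasure α]
  [IsFiniteMeasure β] {f g : C(X, ℝ)}

theorem _root_.Continuous.integrable_of_compactSpace {Y : Type*} [TopologicalSpace Y]
    [CompactSpace Y] [MeasurableSpace Y] [OpensMeasurableSpace Y] {μ : Measure Y}
    [IsFiniteMeasure μ] {u : Y → ℝ} (hu : Continuous u) : Integrable u μ :=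
  hu.integrable_of_hasCompactSupport (HasCompactSupport.of_compactSpace u)

theorem _root_.Continuous.exists_abs_le {Y : Type*} [TopologicalSpace Y] [CompactSpace Y]
    {u : Y → ℝ} (hu : Continuous u) : ∃ M, 0 < M ∧ ∀ y, |u y| ≤ M := by
  obtain ⟨M, hM⟩ := isCompact_univ.exists_bound_of_continuousOn hu.continuousOn
  exact ⟨max M 1, by positivity, fun y => (hM y trivial).trans (le_max_left _ _)⟩

/-- The density `exp((f(x) + g(y) - C(x, y)) / ε)` of the transport plan generated by the
potentials `f` and `g`. -/
noncomputable def planDensity (C : X → X → ℝ) (ε : ℝ) (f g : C(X, ℝ)) (z : X × X) : ℝ :=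
  Real.exp ((f z.1 + g z.2 - C z.1 z.2) / ε)

/-- The density of the first marginal of the plan generated by `f` and `g`. -/
noncomputable def marginalDensity (C : X → X → ℝ) (ε : ℝ) (β : Measure X) (f g : C(X, ℝ))
    (x : X) : ℝ :=
  ∫ y, planDensity C ε f g (x, y) ∂β

omit [CompactSpace X] [MeasurableSpace X] [BorelSpace X] in
theorem planDensity_pos (z : X × X) : 0 < planDensity C ε f g z :=
  Real.exp_pos _

omit [CompactSpace X] [MeasurableSpace X] [BorelSpace X] in
theorem continuous_planDensity (hC : Continuous (Function.uncurry C)) :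
    Continuous (planDensity C ε f g) := by
  have : Continuous fun z : X × X => C z.1 z.2 := hC
  unfold planDensity
  fun_prop

theorem continuous_marginalDensity (hC : Continuous (Function.uncurry C)) :
    Continuous (marginalDensity C ε β f g) := by
  have := continuous_parametric_integral_of_continuous (μ := β)
    (f := fun x y => planDensity C ε f g (x, y)) (continuous_planDensity hC) isCompact_univ
  rw [Measure.restrict_univ] at this
  exact this

omit [CompactSpace X] [BorelSpace X] [IsFiniteMeasure β] in
theorem marginalDensity_nonneg (x : X) : 0 ≤ marginalDensity C ε β f g x :=
  integral_nonneg fun _ => (planDensity_pos _).le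

omit [CompactSpace X] [MeasurableSpace X] [BorelSpace X] in
theorem planDensity_swap (hCsymm : ∀ x y, C x y = C y x) (z : X × X) :
    planDensity C ε f g z.swap = planDensity C ε g f z := by
  simp only [planDensity, Prod.fst_swap, Prod.snd_swap]
  rw [hCsymm, add_comm (f z.2)]

theorem integral_planDensity_mul_fst (hC : Continuous (Function.uncurry C)) {v : X → ℝ}
    (hv : Continuous v) :
    ∫ z, planDensity C ε f g z * v z.1 ∂(α.prod β)
      = ∫ x, marginalDensity C ε β f g x * v x ∂α := by
  have hcont : Continuous fun z : X × X => planDensity C ε f g z * v z.1 :=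
    (continuous_planDensity hC).mul (hv.comp continuous_fst)
  rw [integral_prod _ hcont.integrable_of_compactSpace]
  simp only [integral_mul_const, marginalDensity]

theorem integral_planDensity_mul_snd (hCsymm : ∀ x y, C x y = C y x) (v : X → ℝ) :
    ∫ z, planDensity C ε f f z * v z.2 ∂(α.prod α)
      = ∫ z, planDensity C ε f f z * v z.1 ∂(α.prod α) := by
  rw [← integral_prod_swap]
  simp only [planDensity_swap hCsymm, Prod.snd_swap]

omit [CompactSpace X] [BorelSpace X] in
theorem symDual_eq (φ : ℝ≥0 → ℝ≥0∞) (C : X → X → ℝ) (ε : ℝ) (α : Measure X) (f : C(X, ℝ)) :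
    symDual φ C ε α f = -integralEReal α (fun x => conjugate φ (-f x)) -
      ((ε / 2 * ∫ z, planDensity C ε f f z ∂(α.prod α) : ℝ) : EReal) := rfl

omit [CompactSpace X] [BorelSpace X] [IsFiniteMeasure α] in
theorem le_symDual {v : X → ℝ} (hv : Integrable v α)
    (hle : ∀ᵐ x ∂α, conjugate φ (-f x) ≤ (v x : EReal)) {c : ℝ}
    (hc : ε / 2 * ∫ z, planDensity C ε f f z ∂(α.prod α) ≤ c) :
    ((-∫ x, v x ∂α - c : ℝ) : EReal) ≤ symDual φ C ε α f := by
  rw [symDual_eq, EReal.coe_sub, EReal.coe_neg]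
  exact EReal.sub_le_sub (EReal.neg_le_neg_iff.2 (integralEReal_le_integral hv hle))
    (EReal.coe_le_coe_iff.2 hc)

omit [CompactSpace X] [BorelSpace X] [IsFiniteMeasure α] in
theorem IsOptimalPotential.symDual_le (hf : IsOptimalPotential φ C ε α f) (h : C(X, ℝ)) :
    symDual φ C ε α h ≤ symDual φ C ε α f := by
  rw [IsOptimalPotential, sinkhornEntropy, neg_inj] at hf
  rw [hf]
  exact le_iSup (symDual φ C ε α) h

/-- The real-valued version of `x ↦ φ*(-f(x))`. -/
noncomputable def conjugatePotential (φ : ℝ≥0 → ℝ≥0∞) (f : C(X, ℝ)) (x : X) : ℝ :=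
  (conjugate φ (-f x)).toReal

/-- Comparison with the zero potential, whose dual value is finite from below since `φ*(0) ≤ 0`,
excludes `∫ φ*(-f) dα = ∞`. The lower bound on `φ*(-f)` comes from `q ≤ φ*(q)`. -/
theorem IsOptimalPotential.conjugatePotential_spec (hφ : IsEntropy φ)
    (hf : IsOptimalPotential φ C ε α f) :
    (∀ᵐ x ∂α, conjugate φ (-f x) = (conjugatePotential φ f x : EReal)) ∧
      Integrable (conjugatePotential φ f) α := by
  obtain ⟨M, -, hM⟩ := f.continuous.exists_abs_le
  refine ae_eq_toReal_of_integralEReal_ne_top (M := -M)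
    (measurable_conjugate.comp f.continuous.neg.measurable) (fun x => ?_) fun htop => ?_
  · exact (EReal.coe_le_coe_iff.2 (by linarith [le_abs_self (f x), hM x])).trans
      (hφ.le_conjugate _)
  · have h0 : ((-∫ x, (0 : ℝ) ∂α - ε / 2 * ∫ z, planDensity C ε 0 0 z ∂(α.prod α) : ℝ) : EReal)
        ≤ symDual φ C ε α 0 :=
      le_symDual (integrable_zero _ _ _)
        (ae_of_all _ fun x => by simpa using conjugate_zero_le) le_rfl
    have h1 := h0.trans (hf.symDual_le 0)
    rw [symDual_eq, htop, EReal.neg_top, EReal.bot_sub, le_bot_iff] at h1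
    exact EReal.coe_ne_bot _ h1

theorem IsOptimalPotential.symDual_eq_coe (hφ : IsEntropy φ)
    (hf : IsOptimalPotential φ C ε α f) :
    symDual φ C ε α f = ((-∫ x, conjugatePotential φ f x ∂α
      - ε / 2 * ∫ z, planDensity C ε f f z ∂(α.prod α) : ℝ) : EReal) := by
  obtain ⟨h1, h2⟩ := hf.conjugatePotential_spec hφ
  have h3 : integralEReal α (fun x => conjugate φ (-f x))
      = ((∫ x, conjugatePotential φ f x ∂α : ℝ) : EReal) := by
    rw [← integralEReal_coe h2]
    exact le_antisymm (integralEReal_mono_ae (h1.mono fun x hx => hx.le))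
      (integralEReal_mono_ae (h1.mono fun x hx => hx.ge))
  rw [symDual_eq, h3, EReal.coe_sub, EReal.coe_neg]

theorem nonneg_of_forall_le_mul_add_sq {A B δ : ℝ} (hδ : 0 < δ)
    (h : ∀ t, 0 < t → t ≤ δ → 0 ≤ t * A + t ^ 2 * B) : 0 ≤ A := by
  by_contra! hA
  have hB : 0 < |B| + 1 := by positivity
  set t := min δ (-A / (2 * (|B| + 1))) with ht
  have ht0 : 0 < t := lt_min hδ (div_pos (neg_pos.2 hA) (by positivity))
  have h1 := h t ht0 (min_le_left _ _)
  have h2 : t * (|B| + 1) ≤ -A / 2 := by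
    calc t * (|B| + 1) ≤ -A / (2 * (|B| + 1)) * (|B| + 1) :=
          mul_le_mul_of_nonneg_right (min_le_right _ _) hB.le
      _ = -A / 2 := by field_simp
  have h3 : t * B ≤ -A / 2 := le_trans
    (mul_le_mul_of_nonneg_left (by linarith [le_abs_self B]) ht0.le) h2
  have h4 : t * A + t ^ 2 * B = t * (A + t * B) := by ring
  rw [h4] at h1
  have := nonneg_of_mul_nonneg_right h1 ht0
  linarith

/-- The first variation of the symmetric dual functional at an optimal potential, in the direction
of a localized constant. -/
theorem IsOptimalPotential.integral_mul_nonneg (hφ : IsEntropy φ)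
    (hC : Continuous (Function.uncurry C)) (hCsymm : ∀ x y, C x y = C y x) (hε : 0 < ε)
    (hf : IsOptimalPotential φ C ε α f) {s c : ℝ} (hs : conjugate φ (-s) ≤ (c : EReal))
    (χ : C(X, ℝ)) (hχ₀ : ∀ x, 0 ≤ χ x) (hχ₁ : ∀ x, χ x ≤ 1) :
    0 ≤ ∫ x, χ x * (c - conjugatePotential φ f x
      + marginalDensity C ε α f f x * (s - f x)) ∂α := by
  obtain ⟨hw, hwint⟩ := hf.conjugatePotential_spec hφ
  set w := conjugatePotential φ f with hw_def
  set D := planDensity C ε f f with hD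
  have hDc : Continuous D := continuous_planDensity hC
  have hDint : Integrable D (α.prod α) := hDc.integrable_of_compactSpace
  -- `f + t v` is the pointwise convex combination `(1 - tχ) f + tχ s`, so `φ*(-(f + t v))` is
  -- bounded by convexity alone.
  set v : C(X, ℝ) := χ * (ContinuousMap.const X s - f) with hv
  have hvx : ∀ x, v x = χ x * (s - f x) := fun x => rfl
  set V : X × X → ℝ := fun z => (v z.1 + v z.2) / ε with hV
  have hVc : Continuous V := by fun_prop
  have hDVint : Integrable (fun z => D z * V z) (α.prod α) :=
    (hDc.mul hVc).integrable_of_compactSpace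
  obtain ⟨M, hM0, hM⟩ := hVc.exists_abs_le
  obtain ⟨N, -, hN⟩ := χ.continuous.exists_abs_le
  have hχint : Integrable (fun x => χ x * (c - w x)) α :=
    ((integrable_const c).sub hwint).bdd_mul χ.continuous.aestronglyMeasurable
      (ae_of_all _ hN)
  have key : 0 ≤ ∫ x, χ x * (c - w x) ∂α + ε / 2 * ∫ z, D z * V z ∂(α.prod α) := by
    -- `t ≤ 1` keeps the convex weights in `[0, 1]`; `t M ≤ 1` allows the quadratic bound on `exp (t
    -- V) - 1 - t V`.
    refine nonneg_of_forall_le_mul_add_sq (B := ε / 2 * (M ^ 2 * ∫ z, D z ∂(α.prod α)))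
      (lt_min one_pos (inv_pos.2 hM0)) fun t ht0 ht => ?_
    have ht1 : t ≤ 1 := ht.trans (min_le_left _ _)
    have htM : t * M ≤ 1 := by
      calc t * M ≤ M⁻¹ * M := mul_le_mul_of_nonneg_right (ht.trans (min_le_right _ _)) hM0.le
        _ = 1 := inv_mul_cancel₀ hM0.ne'
    have hconj : ∀ᵐ x ∂α, conjugate φ (-(f + t • v) x)
        ≤ ((w x + t * (χ x * (c - w x)) : ℝ) : EReal) := by
      filter_upwards [hw] with x hx
      have h1 := conjugate_convex_comb_le hx.le hs (mul_nonneg ht0.le (hχ₀ x))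
        (mul_le_one₀ ht1 (hχ₀ x) (hχ₁ x))
      convert h1 using 2
      · simp only [ContinuousMap.add_apply, ContinuousMap.smul_apply, hvx, smul_eq_mul]
        ring
      · ring
    have hplan : ∀ z, planDensity C ε (f + t • v) (f + t • v) z
        ≤ D z + t * (D z * V z) + t ^ 2 * M ^ 2 * D z := fun z => by
      have h1 : planDensity C ε (f + t • v) (f + t • v) z = D z * Real.exp (t * V z) := by
        simp only [hD, planDensity, hV, ContinuousMap.add_apply, ContinuousMap.smul_apply,
          smul_eq_mul]
        rw [← Real.exp_add]
        congr 1
        ring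
      have h2 : |t * V z| ≤ t * M := by
        rw [abs_mul, abs_of_pos ht0]
        exact mul_le_mul_of_nonneg_left (hM z) ht0.le
      have h3 := (abs_le.1 (Real.abs_exp_sub_one_sub_id_le (h2.trans htM))).2
      have h4 : (t * V z) ^ 2 ≤ (t * M) ^ 2 := sq_le_sq' (abs_le.1 h2).1 (abs_le.1 h2).2
      rw [h1]
      calc D z * Real.exp (t * V z) ≤ D z * (1 + t * V z + (t * M) ^ 2) :=
            mul_le_mul_of_nonneg_left (by linarith) (planDensity_pos z).le
        _ = _ := by ring
    have hplan' : ∫ z, planDensity C ε (f + t • v) (f + t • v) z ∂(α.prod α)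
        ≤ ∫ z, D z ∂(α.prod α) + t * ∫ z, D z * V z ∂(α.prod α)
          + t ^ 2 * M ^ 2 * ∫ z, D z ∂(α.prod α) := by
      have h12 : Integrable (fun z => D z + t * (D z * V z)) (α.prod α) :=
        hDint.add (hDVint.const_mul t)
      rw [← integral_const_mul, ← integral_const_mul, ← integral_add hDint (hDVint.const_mul t),
        ← integral_add h12 (hDint.const_mul _)]
      exact integral_mono (continuous_planDensity hC).integrable_of_compactSpace
        (h12.add (hDint.const_mul _)) hplan
    have h1 := (le_symDual (hwint.add (hχint.const_mul t)) hconj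
      (mul_le_mul_of_nonneg_left hplan' (half_pos hε).le)).trans (hf.symDual_le (f + t • v))
    rw [hf.symDual_eq_coe hφ, EReal.coe_le_coe_iff] at h1
    simp only [Pi.add_apply] at h1
    rw [integral_add hwint (hχint.const_mul t), integral_const_mul] at h1
    linarith
  -- By symmetry of `C` both variables contribute equally, which absorbs the factor `1/2`; the `1/ε`
  -- in `V` absorbs `ε`.
  have hsum : ε / 2 * ∫ z, D z * V z ∂(α.prod α)
      = ∫ x, marginalDensity C ε α f f x * v x ∂α := by
    rw [← integral_planDensity_mul_fst hC v.continuous]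
    have h1 : ∀ z, D z * V z = ε⁻¹ * (D z * v z.1) + ε⁻¹ * (D z * v z.2) := fun z => by
      simp only [hV]
      field_simp
    simp only [h1]
    rw [integral_add, integral_const_mul, integral_const_mul,
      integral_planDensity_mul_snd hCsymm]
    · field_simp
      ring
    · exact Continuous.integrable_of_compactSpace (by fun_prop)
    · exact Continuous.integrable_of_compactSpace (by fun_prop)
  have hpv : Integrable (fun x => marginalDensity C ε α f f x * v x) α :=
    ((continuous_marginalDensity hC).mul v.continuous).integrable_of_compactSpace
  rw [hsum, ← integral_add hχint hpv] at key
  refine key.trans_eq (integral_congr_ae (ae_of_all _ fun x => ?_))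
  simp only [hvx]
  ring

end FirstOrder

/-! ### Pointwise optimality condition. -/

section OptimalityCondition

variable {X : Type*} [MetricSpace X] [CompactSpace X] [MeasurableSpace X] [BorelSpace X]
  {φ : ℝ≥0 → ℝ≥0∞} {C : X → X → ℝ} {ε : ℝ} {α : Measure X} [IsFiniteMeasure α] {f : C(X, ℝ)}

omit [CompactSpace X] [IsFiniteMeasure α] in
theorem setIntegral_nonneg_of_forall_integral_mul_nonneg {G : X → ℝ} (hG : Integrable G α)
    (h : ∀ χ : C(X, ℝ), (∀ x, 0 ≤ χ x) → (∀ x, χ x ≤ 1) → 0 ≤ ∫ x, χ x * G x ∂α)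
    {F : Set X} (hF : IsClosed F) : 0 ≤ ∫ x in F, G x ∂α := by
  rw [← integral_indicator hF.measurableSet]
  refine ge_of_tendsto' (f := fun n => ∫ x, (hF.apprSeq n x : ℝ) * G x ∂α) (x := atTop)
    (tendsto_integral_of_dominated_convergence (fun x => ‖G x‖) (fun n => ?_) hG.norm
      (fun n => ae_of_all _ fun x => ?_) (ae_of_all _ fun x => ?_)) fun n => ?_
  · exact (NNReal.continuous_coe.comp (hF.apprSeq n).continuous).aestronglyMeasurable.mul hG.1
  · rw [norm_mul]
    refine mul_le_of_le_one_left (norm_nonneg _) ?_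
    simpa using HasOuterApproxClosed.apprSeq_apply_le_one hF n x
  · have h1 := tendsto_pi_nhds.1 (HasOuterApproxClosed.tendsto_apprSeq hF) x
    have h2 := ((NNReal.continuous_coe.tendsto _).comp h1).mul_const (G x)
    have h3 : F.indicator G x = ((F.indicator (fun _ => (1 : ℝ≥0)) x : ℝ≥0) : ℝ) * G x := by
      by_cases hx : x ∈ F <;> simp [hx]
    rw [h3]
    exact h2
  · exact h ⟨fun x => (hF.apprSeq n x : ℝ), NNReal.continuous_coe.comp (hF.apprSeq n).continuous⟩
      (fun x => NNReal.coe_nonneg _)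
      (fun x => by exact_mod_cast HasOuterApproxClosed.apprSeq_apply_le_one hF n x)

/-- If `G` were negative on a set of positive measure, inner regularity would give a closed subset
of positive measure, whose indicator is a limit of admissible `χ`. -/
theorem ae_nonneg_of_forall_integral_mul_nonneg {G : X → ℝ} (hG : Integrable G α)
    (h : ∀ χ : C(X, ℝ), (∀ x, 0 ≤ χ x) → (∀ x, χ x ≤ 1) → 0 ≤ ∫ x, χ x * G x ∂α) :
    ∀ᵐ x ∂α, 0 ≤ G x := by
  obtain ⟨G', hG'm, hGG'⟩ := hG.1
  have hG' : Integrable G' α := hG.congr hGG'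
  suffices hN : α {x | G' x < 0} = 0 by
    filter_upwards [hGG', measure_eq_zero_iff_ae_notMem.1 hN] with x hx hx'
    rw [hx]
    exact not_lt.1 hx'
  by_contra hN
  have hNm : MeasurableSet {x | G' x < 0} := hG'm.measurable measurableSet_Iio
  obtain ⟨F, hFN, hF, hpos⟩ := hNm.exists_lt_isClosed_of_ne_top (measure_ne_top α _)
    (pos_iff_ne_zero.2 hN)
  have h1 := setIntegral_nonneg_of_forall_integral_mul_nonneg hG h hF
  rw [setIntegral_congr_ae hF.measurableSet (hGG'.mono fun x hx _ => hx)] at h1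
  have hneg : 0 ≤ᵐ[α.restrict F] fun x => -G' x :=
    (ae_restrict_iff' hF.measurableSet).2 (ae_of_all _ fun x hx => neg_nonneg.2 (hFN hx).le)
  have h2 : ∫ x in F, -G' x ∂α = 0 :=
    le_antisymm (by rw [integral_neg]; linarith) (integral_nonneg_of_ae hneg)
  rw [setIntegral_eq_zero_iff_of_nonneg_ae hneg hG'.neg.integrableOn] at h2
  have h3 := (ae_restrict_iff' hF.measurableSet).1 h2
  refine hpos.ne' (measure_eq_zero_iff_ae_notMem.2 ?_)
  filter_upwards [h3] with x hx hxF
  have h4 : -G' x = 0 := hx hxF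
  have h5 : G' x < 0 := hFN hxF
  linarith

/-- The optimality condition: the marginal density `p` of an optimal potential `f` satisfies
`φ(p) + φ*(-f) ≤ -p f` almost everywhere. -/
theorem IsOptimalPotential.ae_entropy_le (hφ : IsEntropy φ)
    (hC : Continuous (Function.uncurry C)) (hCsymm : ∀ x y, C x y = C y x) (hε : 0 < ε)
    (hf : IsOptimalPotential φ C ε α f) :
    ∀ᵐ x ∂α, ((φ (marginalDensity C ε α f f x).toNNReal : ℝ≥0∞) : EReal)
      ≤ ((-conjugatePotential φ f x - marginalDensity C ε α f f x * f x : ℝ) : EReal) := by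
  -- The exceptional null set depends on the minorant; restricting to rational pairs leaves
  -- countably many. The constant used is `s = -q`.
  have h : ∀ᵐ x ∂α, ∀ q c : ℚ, conjugate φ q ≤ ((c : ℝ) : EReal) →
      0 ≤ c - conjugatePotential φ f x + marginalDensity C ε α f f x * (-q - f x) := by
    refine ae_all_iff.2 fun q => ae_all_iff.2 fun c =>
      Filter.eventually_imp_distrib_left.2 fun hqc => ?_
    have hp := continuous_marginalDensity (ε := ε) (β := α) (f := f) (g := f) hC
    refine ae_nonneg_of_forall_integral_mul_nonneg
      (((integrable_const _).sub (hf.conjugatePotential_spec hφ).2).add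
        (Continuous.integrable_of_compactSpace (by fun_prop))) fun χ hχ₀ hχ₁ => ?_
    exact hf.integral_mul_nonneg hφ hC hCsymm hε (by simpa using hqc) χ hχ₀ hχ₁
  filter_upwards [h] with x hx
  have hp : ((marginalDensity C ε α f f x).toNNReal : ℝ) = marginalDensity C ε α f f x :=
    Real.coe_toNNReal _ (marginalDensity_nonneg x)
  have := hφ.coe_le_of_forall_rat (p := (marginalDensity C ε α f f x).toNNReal)
    (w := conjugatePotential φ f x) (f := f x) (by simpa only [hp] using hx)
  simpa only [hp] using this

end OptimalityCondition

/-! ### Upper bound on the self-cost by the plan of an optimal potential. -/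

section Primal

theorem fst_withDensity_prod {X Y : Type*} [MeasurableSpace X] [MeasurableSpace Y] {α : Measure X}
    {β : Measure Y} [SFinite α] [SFinite β] {h : X × Y → ℝ≥0∞} (hh : Measurable h) :
    ((α.prod β).withDensity h).fst = α.withDensity fun x => ∫⁻ y, h (x, y) ∂β := by
  ext s hs
  rw [Measure.fst_apply hs, withDensity_apply _ (measurable_fst hs), withDensity_apply _ hs,
    ← Set.prod_univ, ← Measure.prod_restrict, Measure.restrict_univ,
    lintegral_prod _ hh.aemeasurable]

theorem snd_withDensity_prod {X Y : Type*} [MeasurableSpace X] [MeasurableSpace Y] {α : Measure X}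
    {β : Measure Y} [SFinite α] [SFinite β] {h : X × Y → ℝ≥0∞} (hh : Measurable h) :
    ((α.prod β).withDensity h).snd = β.withDensity fun y => ∫⁻ x, h (x, y) ∂α := by
  ext s hs
  rw [Measure.snd_apply hs, withDensity_apply _ (measurable_snd hs), withDensity_apply _ hs,
    ← Set.univ_prod, ← Measure.prod_restrict, Measure.restrict_univ,
    lintegral_prod_symm _ hh.aemeasurable]

theorem csiszarDiv_withDensity {X : Type*} [MeasurableSpace X] {φ : ℝ≥0 → ℝ≥0∞} {α : Measure X}
    [IsFiniteMeasure α] {p : X → ℝ} (hp : Measurable p) :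
    csiszarDiv φ (α.withDensity fun x => ENNReal.ofReal (p x)) α
      = ∫⁻ x, φ (p x).toNNReal ∂α := by
  have hs : (α.withDensity fun x => ENNReal.ofReal (p x)).singularPart α = 0 :=
    Measure.singularPart_eq_zero_of_ac (withDensity_absolutelyContinuous _ _)
  rw [csiszarDiv, hs, Measure.coe_zero, Pi.zero_apply, mul_zero, add_zero]
  refine lintegral_congr_ae ?_
  filter_upwards [Measure.rnDeriv_withDensity α (hp.ennreal_ofReal)] with x hx
  rw [hx]
  rfl

theorem klDiv_withDensity {Y : Type*} [MeasurableSpace Y] {ν : Measure Y}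
    [IsFiniteMeasure ν] {D : Y → ℝ} (hD : Measurable D) (hD₀ : ∀ y, 0 ≤ D y)
    (hDint : Integrable D ν) (hkl : Integrable (fun y => InformationTheory.klFun (D y)) ν) :
    InformationTheory.klDiv (ν.withDensity fun y => ENNReal.ofReal (D y)) ν
      = ENNReal.ofReal (∫ y, InformationTheory.klFun (D y) ∂ν) := by
  have : IsFiniteMeasure (ν.withDensity fun y => ENNReal.ofReal (D y)) :=
    isFiniteMeasure_withDensity_ofReal hDint.2
  rw [InformationTheory.klDiv_eq_lintegral_klFun_of_ac (withDensity_absolutelyContinuous _ _),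
    ofReal_integral_eq_lintegral_ofReal hkl
      (ae_of_all _ fun y => InformationTheory.klFun_nonneg (hD₀ y))]
  refine lintegral_congr_ae ?_
  filter_upwards [Measure.rnDeriv_withDensity ν hD.ennreal_ofReal] with y hy
  rw [hy, ENNReal.toReal_ofReal (hD₀ y)]

theorem coe_ennreal_add_add_mul_le {A B K : ℝ≥0∞} {a b k ε : ℝ} (ha : 0 ≤ a) (hb : 0 ≤ b)
    (hk : 0 ≤ k) (hε : 0 ≤ ε) (hA : A ≤ ENNReal.ofReal a) (hB : B ≤ ENNReal.ofReal b)
    (hK : K ≤ ENNReal.ofReal k) :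
    ((A + B + ENNReal.ofReal ε * K : ℝ≥0∞) : EReal) ≤ ((a + b + ε * k : ℝ) : EReal) := by
  have h : A + B + ENNReal.ofReal ε * K ≤ ENNReal.ofReal (a + b + ε * k) := by
    rw [ENNReal.ofReal_add (by positivity) (by positivity), ENNReal.ofReal_add ha hb,
      ENNReal.ofReal_mul hε]
    gcongr
  refine (EReal.coe_ennreal_le_coe_ennreal_iff.2 h).trans_eq ?_
  rw [EReal.coe_ennreal_ofReal, max_eq_left (by positivity)]

variable {X : Type*} [MetricSpace X] [CompactSpace X] [MeasurableSpace X] [BorelSpace X]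
  {φ : ℝ≥0 → ℝ≥0∞} {C : X → X → ℝ} {ε : ℝ} {α : Measure X} [IsFiniteMeasure α] {f : C(X, ℝ)}

/-- The plan generated by an optimal symmetric potential bounds `OT_ε(α, α)` by the dual value. -/
theorem IsOptimalPotential.OT_self_le (hφ : IsEntropy φ)
    (hC : Continuous (Function.uncurry C)) (hCsymm : ∀ x y, C x y = C y x) (hε : 0 < ε)
    (hf : IsOptimalPotential φ C ε α f) :
    OT φ C ε α α ≤ ((-2 * ∫ x, conjugatePotential φ f x ∂α
      - ε * ∫ z, planDensity C ε f f z ∂(α.prod α) + ε * α.real Set.univ ^ 2 : ℝ) : EReal) := by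
  have hwint := (hf.conjugatePotential_spec hφ).2
  have hopt := hf.ae_entropy_le hφ hC hCsymm hε
  set w := conjugatePotential φ f
  set p := marginalDensity C ε α f f
  set D := planDensity C ε f f with hD
  have hDc : Continuous D := continuous_planDensity hC
  have hD₀ : ∀ z, 0 ≤ D z := fun z => (planDensity_pos z).le
  have hDint : Integrable D (α.prod α) := hDc.integrable_of_compactSpace
  have hpc : Continuous p := continuous_marginalDensity hC
  have hC' : Continuous fun z : X × X => C z.1 z.2 := hC
  have hDm : Measurable fun z => ENNReal.ofReal (D z) := hDc.measurable.ennreal_ofReal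
  have hfin : IsFiniteMeasure ((α.prod α).withDensity fun z => ENNReal.ofReal (D z)) :=
    isFiniteMeasure_withDensity_ofReal hDint.2
  set π : FiniteMeasure (X × X) := ⟨(α.prod α).withDensity fun z => ENNReal.ofReal (D z), hfin⟩
  have hfst : (π : Measure (X × X)).fst = α.withDensity fun x => ENNReal.ofReal (p x) := by
    refine (fst_withDensity_prod hDm).trans ?_
    congr 1
    funext x
    exact (ofReal_integral_eq_lintegral_ofReal
      (hDc.comp (Continuous.prodMk_right x)).integrable_of_compactSpace
      (ae_of_all _ fun y => hD₀ _)).symm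
  -- Symmetry of `C` makes both marginals equal, so one optimality condition controls both
  -- divergences.
  have hsnd : (π : Measure (X × X)).snd = α.withDensity fun x => ENNReal.ofReal (p x) := by
    refine (snd_withDensity_prod hDm).trans ?_
    congr 1
    funext x
    refine (lintegral_congr fun y => ?_).trans (ofReal_integral_eq_lintegral_ofReal
      (hDc.comp (Continuous.prodMk_right x)).integrable_of_compactSpace
      (ae_of_all _ fun y => hD₀ _)).symm
    exact congrArg ENNReal.ofReal (planDensity_swap hCsymm (x, y))
  have hpf : Integrable (fun x => p x * f x) α :=
    (hpc.mul f.continuous).integrable_of_compactSpace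
  have hwpf : Integrable (fun x => -w x - p x * f x) α := hwint.neg.sub hpf
  have hnn : 0 ≤ᵐ[α] fun x => -w x - p x * f x := by
    filter_upwards [hopt] with x hx
    exact EReal.coe_nonneg.1 ((EReal.coe_ennreal_nonneg _).trans hx)
  have hdiv : csiszarDiv φ (α.withDensity fun x => ENNReal.ofReal (p x)) α
      ≤ ENNReal.ofReal (∫ x, -w x - p x * f x ∂α) := by
    rw [csiszarDiv_withDensity hpc.measurable, ofReal_integral_eq_lintegral_ofReal hwpf hnn]
    refine lintegral_mono_ae ?_
    filter_upwards [hopt, hnn] with x hx hx'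
    have hx' : 0 ≤ -w x - p x * f x := hx'
    rwa [← EReal.coe_ennreal_le_coe_ennreal_iff, EReal.coe_ennreal_ofReal, max_eq_left hx']
  have hklc : Continuous fun z => InformationTheory.klFun (D z) :=
    InformationTheory.continuous_klFun.comp hDc
  have hkl : InformationTheory.klDiv (π : Measure (X × X)) (α.prod α)
      ≤ ENNReal.ofReal (∫ z, InformationTheory.klFun (D z) ∂(α.prod α)) :=
    (klDiv_withDensity hDc.measurable hD₀ hDint hklc.integrable_of_compactSpace).le
  have hcost : ∫ z, C z.1 z.2 ∂(π : Measure (X × X)) = ∫ z, D z * C z.1 z.2 ∂(α.prod α) := by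
    refine (integral_withDensity_eq_integral_toReal_smul hDm
      (ae_of_all _ fun _ => ENNReal.ofReal_lt_top) _).trans ?_
    simp only [ENNReal.toReal_ofReal (hD₀ _), smul_eq_mul]
  -- Since `ε log D = f ⊕ f - C`, the entropy yields `2 ∫ p f dα`, which cancels against the two
  -- divergence bounds, and `-∫ C dπ`, which cancels the transport cost.
  have hklval : ε * ∫ z, InformationTheory.klFun (D z) ∂(α.prod α)
      = 2 * ∫ x, p x * f x ∂α - ∫ z, D z * C z.1 z.2 ∂(α.prod α)
        + ε * α.real Set.univ ^ 2 - ε * ∫ z, D z ∂(α.prod α) := by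
    have h1 : ∀ z, InformationTheory.klFun (D z)
        = ε⁻¹ * (D z * f z.1 + D z * f z.2 - D z * C z.1 z.2) + (1 - D z) := fun z => by
      rw [InformationTheory.klFun_apply, hD, planDensity, Real.log_exp]
      ring
    have i1 : Integrable (fun z : X × X => D z * f z.1) (α.prod α) :=
      Continuous.integrable_of_compactSpace (by fun_prop)
    have i2 : Integrable (fun z : X × X => D z * f z.2) (α.prod α) :=
      Continuous.integrable_of_compactSpace (by fun_prop)
    have i3 : Integrable (fun z : X × X => D z * C z.1 z.2) (α.prod α) :=
      Continuous.integrable_of_compactSpace (by fun_prop)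
    have i12 : Integrable (fun z : X × X => D z * f z.1 + D z * f z.2) (α.prod α) := i1.add i2
    have i123 : Integrable (fun z : X × X => D z * f z.1 + D z * f z.2 - D z * C z.1 z.2)
      (α.prod α) := i12.sub i3
    have i0 : Integrable (fun z => 1 - D z) (α.prod α) := (integrable_const _).sub hDint
    simp only [h1]
    rw [integral_add (i123.const_mul _) i0, integral_const_mul,
      integral_sub i12 i3, integral_add i1 i2, integral_sub (integrable_const _) hDint,
      integral_planDensity_mul_snd hCsymm, integral_planDensity_mul_fst hC f.continuous,
      integral_const, measureReal_def, ← Set.univ_prod_univ, Measure.prod_prod,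
      ENNReal.toReal_mul, ← measureReal_def, smul_eq_mul, mul_one]
    field_simp
    ring
  have hint0 : 0 ≤ ∫ x, -w x - p x * f x ∂α := integral_nonneg_of_ae hnn
  refine (iInf_le _ π).trans ((add_le_add_right (coe_ennreal_add_add_mul_le hint0 hint0
    (integral_nonneg fun z => InformationTheory.klFun_nonneg (hD₀ z)) hε.le
    (hfst ▸ hdiv) (hsnd ▸ hdiv) hkl) _).trans ?_)
  have hwpfval : ∫ x, -w x - p x * f x ∂α = -∫ x, w x ∂α - ∫ x, p x * f x ∂α := by
    rw [← integral_neg]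
    exact integral_sub hwint.neg hpf
  rw [← EReal.coe_add, EReal.coe_le_coe_iff, hklval, hcost, hwpfval]
  linarith

end Primal

/-! ### Weak duality for arbitrary continuous potentials. -/

section WeakDuality

theorem ofReal_integral_le_lintegral {Y : Type*} [MeasurableSpace Y] {ν : Measure Y} {u : Y → ℝ}
    (hu : Integrable u ν) {H : Y → ℝ≥0∞} (h : ∀ᵐ y ∂ν, ENNReal.ofReal (u y) ≤ H y) :
    ENNReal.ofReal (∫ y, u y ∂ν) ≤ ∫⁻ y, H y ∂ν := by
  refine le_trans ?_ (lintegral_mono_ae h)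
  rw [integral_eq_lintegral_pos_part_sub_lintegral_neg_part hu]
  exact (ENNReal.ofReal_le_ofReal (sub_le_self _ ENNReal.toReal_nonneg)).trans
    ENNReal.ofReal_toReal_le

/-- Fenchel–Young, `φ(r) ≥ -r f - φ*(-f)`, integrated at the density `r = dμ/dα`. -/
theorem le_csiszarDiv {X : Type*} [TopologicalSpace X] [CompactSpace X] [MeasurableSpace X]
    [BorelSpace X] {φ : ℝ≥0 → ℝ≥0∞} {μ α : Measure X} [IsFiniteMeasure μ] [IsFiniteMeasure α]
    (hμ : μ ≪ α) (f : C(X, ℝ)) {w : X → ℝ} (hw : Integrable w α)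
    (hfw : ∀ᵐ x ∂α, conjugate φ (-f x) ≤ (w x : EReal)) :
    ENNReal.ofReal (-∫ x, f x ∂μ - ∫ x, w x ∂α) ≤ csiszarDiv φ μ α := by
  obtain ⟨M, -, hM⟩ := f.continuous.exists_abs_le
  have hint : Integrable (fun x => (μ.rnDeriv α x).toReal * f x) α :=
    Measure.integrable_toReal_rnDeriv.mul_bdd f.continuous.aestronglyMeasurable
      (ae_of_all _ hM)
  have hval : ∫ x, -((μ.rnDeriv α x).toReal * f x) - w x ∂α
      = -∫ x, f x ∂μ - ∫ x, w x ∂α := by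
    rw [← integral_toReal_rnDeriv_mul hμ, ← integral_neg]
    exact integral_sub hint.neg hw
  rw [← hval]
  refine (ofReal_integral_le_lintegral (hint.neg.sub hw) ?_).trans le_self_add
  filter_upwards [hfw] with x hx
  have h := conjugate_le_coe_iff.1 hx (μ.rnDeriv α x).toNNReal
  rwa [ENNReal.coe_toNNReal_eq_toReal, mul_neg] at h

/-- Fenchel–Young for `klFun`, obtained from `1 + x ≤ exp x` at `x = u - log r`. -/
theorem mul_sub_exp_add_one_le_klFun (u : ℝ) {r : ℝ} (hr : 0 ≤ r) :
    r * u - (Real.exp u - 1) ≤ InformationTheory.klFun r := by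
  rw [InformationTheory.klFun_apply]
  rcases hr.eq_or_lt with rfl | hr
  · simp only [zero_mul]
    linarith [Real.exp_pos u]
  · have h1 := mul_le_mul_of_nonneg_left (Real.add_one_le_exp (u - Real.log r)) hr.le
    rw [Real.exp_sub, Real.exp_log hr, mul_div_cancel₀ _ hr.ne'] at h1
    linarith

/-- The Donsker–Varadhan type lower bound for the generalized Kullback–Leibler divergence. -/
theorem le_klDiv {Y : Type*} [TopologicalSpace Y] [CompactSpace Y] [MeasurableSpace Y]
    [BorelSpace Y] {π ν : Measure Y} [IsFiniteMeasure π] [IsFiniteMeasure ν] (hπ : π ≪ ν)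
    (u : C(Y, ℝ)) :
    ENNReal.ofReal (∫ y, u y ∂π - ∫ y, (Real.exp (u y) - 1) ∂ν)
      ≤ InformationTheory.klDiv π ν := by
  obtain ⟨M, -, hM⟩ := u.continuous.exists_abs_le
  have hint : Integrable (fun y => (π.rnDeriv ν y).toReal * u y) ν :=
    Measure.integrable_toReal_rnDeriv.mul_bdd u.continuous.aestronglyMeasurable
      (ae_of_all _ hM)
  have hexp : Integrable (fun y => Real.exp (u y) - 1) ν :=
    Continuous.integrable_of_compactSpace (by fun_prop)
  rw [← integral_toReal_rnDeriv_mul hπ, ← integral_sub hint hexp,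
    InformationTheory.klDiv_eq_lintegral_klFun_of_ac hπ]
  exact ofReal_integral_le_lintegral (hint.sub hexp) (ae_of_all _ fun y =>
    ENNReal.ofReal_le_ofReal (mul_sub_exp_add_one_le_klFun _ ENNReal.toReal_nonneg))

theorem coe_le_coe_ennreal_add_add_mul {A B K : ℝ≥0∞} {a b k ε : ℝ} (hε : 0 ≤ ε)
    (hA : ENNReal.ofReal a ≤ A) (hB : ENNReal.ofReal b ≤ B) (hK : ENNReal.ofReal k ≤ K) :
    ((a + b + ε * k : ℝ) : EReal) ≤ ((A + B + ENNReal.ofReal ε * K : ℝ≥0∞) : EReal) := by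
  have h : ENNReal.ofReal (a + b + ε * k) ≤ A + B + ENNReal.ofReal ε * K := by
    refine ENNReal.ofReal_add_le.trans (add_le_add (ENNReal.ofReal_add_le.trans
      (add_le_add hA hB)) ?_)
    rw [ENNReal.ofReal_mul hε]
    gcongr
  refine le_trans ?_ (EReal.coe_ennreal_le_coe_ennreal_iff.2 h)
  rw [EReal.coe_ennreal_ofReal, EReal.coe_le_coe_iff]
  exact le_max_left _ _

variable {X : Type*} [MetricSpace X] [CompactSpace X] [MeasurableSpace X] [BorelSpace X]
  {φ : ℝ≥0 → ℝ≥0∞} {C : X → X → ℝ} {ε : ℝ} {α β : Measure X} [IsFiniteMeasure α]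
  [IsFiniteMeasure β]

/-- Weak duality for the regularized unbalanced transport problem. -/
theorem le_OT (hC : Continuous (Function.uncurry C)) (hε : 0 < ε) (f g : C(X, ℝ)) {w v : X → ℝ}
    (hw : Integrable w α) (hv : Integrable v β)
    (hfw : ∀ᵐ x ∂α, conjugate φ (-f x) ≤ (w x : EReal))
    (hgv : ∀ᵐ x ∂β, conjugate φ (-g x) ≤ (v x : EReal)) :
    ((-∫ x, w x ∂α - ∫ x, v x ∂β - ε * ∫ z, planDensity C ε f g z ∂(α.prod β)
      + ε * (α.real Set.univ * β.real Set.univ) : ℝ) : EReal) ≤ OT φ C ε α β := by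
  refine le_iInf fun π => ?_
  -- Otherwise the KL term is infinite, as `ε > 0`. Absolute continuity passes to the marginals.
  by_cases hπ : (π : Measure (X × X)) ≪ α.prod β
  swap
  · rw [InformationTheory.klDiv_of_not_ac hπ,
      ENNReal.mul_top (ENNReal.ofReal_pos.2 hε).ne', add_top, EReal.coe_ennreal_top,
      EReal.coe_add_top]
    exact le_top
  have hfst : (π : Measure (X × X)).fst ≪ α :=
    (hπ.map measurable_fst).trans Measure.quasiMeasurePreserving_fst.absolutelyContinuous
  have hsnd : (π : Measure (X × X)).snd ≪ β :=
    (hπ.map measurable_snd).trans Measure.quasiMeasurePreserving_snd.absolutelyContinuous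
  have hC' : Continuous fun z : X × X => C z.1 z.2 := hC
  -- With this `u`, `ε ∫ u dπ` cancels the cost and the potential terms of both marginals, leaving a
  -- bound independent of `π`.
  let u : C(X × X, ℝ) := ⟨fun z => (f z.1 + g z.2 - C z.1 z.2) / ε, by fun_prop⟩
  have key := add_le_add_right (coe_le_coe_ennreal_add_add_mul hε.le (le_csiszarDiv hfst f hw hfw)
    (le_csiszarDiv hsnd g hv hgv) (le_klDiv hπ u))
    ((∫ z, C z.1 z.2 ∂(π : Measure (X × X)) : ℝ) : EReal)
  refine le_trans ?_ key
  rw [← EReal.coe_add, EReal.coe_le_coe_iff]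
  have hDint : Integrable (planDensity C ε f g) (α.prod β) :=
    (continuous_planDensity hC).integrable_of_compactSpace
  have h1 : ∫ z, (Real.exp (u z) - 1) ∂(α.prod β)
      = ∫ z, planDensity C ε f g z ∂(α.prod β) - α.real Set.univ * β.real Set.univ := by
    have h := integral_sub hDint (integrable_const (μ := α.prod β) (1 : ℝ))
    rw [integral_const, measureReal_def, ← Set.univ_prod_univ, Measure.prod_prod,
      ENNReal.toReal_mul, ← measureReal_def, ← measureReal_def, smul_eq_mul, mul_one] at h
    exact h
  have i1 : Integrable (fun z : X × X => f z.1) (π : Measure (X × X)) :=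
    Continuous.integrable_of_compactSpace (by fun_prop)
  have i2 : Integrable (fun z : X × X => g z.2) (π : Measure (X × X)) :=
    Continuous.integrable_of_compactSpace (by fun_prop)
  have i3 : Integrable (fun z : X × X => C z.1 z.2) (π : Measure (X × X)) :=
    hC'.integrable_of_compactSpace
  have i12 : Integrable (fun z : X × X => f z.1 + g z.2) (π : Measure (X × X)) := i1.add i2
  have h2 : ε * ∫ z, u z ∂(π : Measure (X × X)) = ∫ x, f x ∂(π : Measure (X × X)).fst
      + ∫ x, g x ∂(π : Measure (X × X)).snd - ∫ z, C z.1 z.2 ∂(π : Measure (X × X)) := by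
    rw [Measure.fst, Measure.snd,
      integral_map measurable_fst.aemeasurable f.continuous.aestronglyMeasurable,
      integral_map measurable_snd.aemeasurable g.continuous.aestronglyMeasurable,
      ← integral_add i1 i2, ← integral_sub i12 i3, ← integral_const_mul]
    refine integral_congr_ae (ae_of_all _ fun z => ?_)
    change ε * ((f z.1 + g z.2 - C z.1 z.2) / ε) = _
    field_simp
  rw [h1, mul_sub ε (∫ z, u z ∂(π : Measure (X × X))), h2]
  linarith

end WeakDuality

/-! ### The kernel norm in terms of plan masses. -/

section KernelNorm

variable {X : Type*} [MetricSpace X] [CompactSpace X] [MeasurableSpace X] [BorelSpace X]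

theorem kernelNormSq_toSignedMeasure_sub {k : X → X → ℝ} (hk : Continuous (Function.uncurry k))
    (a b : Measure X) [IsFiniteMeasure a] [IsFiniteMeasure b] :
    kernelNormSq k (a.toSignedMeasure - b.toSignedMeasure)
      = ((∫ x, ∫ y, k x y ∂a ∂a) - ∫ x, ∫ y, k x y ∂b ∂a)
        - ((∫ x, ∫ y, k x y ∂a ∂b) - ∫ x, ∫ y, k x y ∂b ∂b) := by
  have hint : ∀ {u : X → ℝ}, Continuous u → ∀ (μ : Measure X) [IsFiniteMeasure μ],
      VectorMeasure.Integrable μ.toSignedMeasure u := fun hu μ _ => by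
    rw [VectorMeasure.Integrable, Measure.variation_toSignedMeasure]
    exact hu.integrable_of_compactSpace
  have hinner : ∀ (μ : Measure X) [IsFiniteMeasure μ], Continuous fun x => ∫ y, k x y ∂μ :=
    fun μ _ => by
      have h := continuous_parametric_integral_of_continuous (μ := μ) hk isCompact_univ
      rw [Measure.restrict_univ] at h
      exact h
  have hkx : ∀ x, Continuous (k x) := fun x => hk.comp (Continuous.prodMk_right x)
  have hdiff : Continuous fun x => (∫ y, k x y ∂a) - ∫ y, k x y ∂b := (hinner a).sub (hinner b)
  rw [kernelNormSq]
  simp only [VectorMeasure.integral_sub_vectorMeasure (hint (hkx _) a) (hint (hkx _) b),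
    VectorMeasure.integral_toSignedMeasure]
  rw [VectorMeasure.integral_sub_vectorMeasure (hint hdiff a) (hint hdiff b),
    VectorMeasure.integral_toSignedMeasure, VectorMeasure.integral_toSignedMeasure,
    integral_sub (hinner a).integrable_of_compactSpace (hinner b).integrable_of_compactSpace,
    integral_sub (hinner a).integrable_of_compactSpace (hinner b).integrable_of_compactSpace]

variable {C : X → X → ℝ} {ε : ℝ}

/-- The weights `exp (f/ε)` and `exp (g/ε)` combine with the Gibbs kernel into `planDensity`, so
kernel products are the masses in the dual bounds. -/
theorem integral_integral_gibbsKernel (hC : Continuous (Function.uncurry C))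
    (α β : Measure X) [IsFiniteMeasure α] [IsFiniteMeasure β] (f g : C(X, ℝ)) :
    ∫ x, ∫ y, gibbsKernel C ε x y
        ∂(β.withDensity fun y => ENNReal.ofReal (Real.exp (g y / ε)))
        ∂(α.withDensity fun x => ENNReal.ofReal (Real.exp (f x / ε)))
      = ∫ z, planDensity C ε f g z ∂(α.prod β) := by
  have hm : ∀ h : C(X, ℝ), Measurable fun x => ENNReal.ofReal (Real.exp (h x / ε)) := fun h =>
    Measurable.ennreal_ofReal (Continuous.measurable (by fun_prop))
  rw [integral_prod _ (continuous_planDensity hC).integrable_of_compactSpace,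
    integral_withDensity_eq_integral_toReal_smul (hm f)
      (ae_of_all _ fun _ => ENNReal.ofReal_lt_top)]
  refine integral_congr_ae (ae_of_all _ fun x => ?_)
  simp only
  rw [integral_withDensity_eq_integral_toReal_smul (hm g)
      (ae_of_all _ fun _ => ENNReal.ofReal_lt_top), smul_eq_mul, ← integral_const_mul]
  refine integral_congr_ae (ae_of_all _ fun y => ?_)
  simp only [ENNReal.toReal_ofReal (Real.exp_pos _).le, smul_eq_mul, gibbsKernel, planDensity]
  rw [← Real.exp_add, ← Real.exp_add]
  congr 1
  ring

theorem kernelNormSq_gibbsKernel (hC : Continuous (Function.uncurry C))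
    (hCsymm : ∀ x y, C x y = C y x) (α β : Measure X) [IsFiniteMeasure α] [IsFiniteMeasure β]
    (f g : C(X, ℝ)) :
    kernelNormSq (gibbsKernel C ε) (α.withDensityᵥ (fun x => Real.exp (f x / ε)) -
        β.withDensityᵥ (fun x => Real.exp (g x / ε)))
      = ∫ z, planDensity C ε f f z ∂(α.prod α) - 2 * ∫ z, planDensity C ε f g z ∂(α.prod β)
        + ∫ z, planDensity C ε g g z ∂(β.prod β) := by
  have hint : ∀ (μ : Measure X) [IsFiniteMeasure μ] (h : C(X, ℝ)),
      Integrable (fun x => Real.exp (h x / ε)) μ := fun μ _ h =>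
    Continuous.integrable_of_compactSpace (by fun_prop)
  have hfa := isFiniteMeasure_withDensity_ofReal (hint α f).2
  have hfb := isFiniteMeasure_withDensity_ofReal (hint β g).2
  -- The densities are positive, so each signed measure comes from a positive one and the norm
  -- expands into ordinary double integrals.
  have hsm : ∀ (μ : Measure X) [IsFiniteMeasure μ] (h : C(X, ℝ))
      [IsFiniteMeasure (μ.withDensity fun x => ENNReal.ofReal (Real.exp (h x / ε)))],
      μ.withDensityᵥ (fun x => Real.exp (h x / ε))
        = (μ.withDensity fun x => ENNReal.ofReal (Real.exp (h x / ε))).toSignedMeasure := by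
    intro μ _ h _
    have hm : Measurable fun x => ENNReal.ofReal (Real.exp (h x / ε)) :=
      Measurable.ennreal_ofReal (Continuous.measurable (by fun_prop))
    rw [← withDensityᵥ_toReal hm.aemeasurable
      ((lintegral_ofReal_le_lintegral_enorm _).trans_lt (hint μ h).2).ne]
    simp only [ENNReal.toReal_ofReal (Real.exp_pos _).le]
  have hk : Continuous (Function.uncurry (gibbsKernel C ε)) := by
    have : Continuous fun z : X × X => C z.1 z.2 := hC
    change Continuous fun z : X × X => Real.exp (-C z.1 z.2 / ε)
    fun_prop
  have hswap : ∫ z, planDensity C ε g f z ∂(β.prod α) = ∫ z, planDensity C ε f g z ∂(α.prod β) := by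
    rw [← integral_prod_swap]
    simp only [planDensity_swap hCsymm]
  rw [hsm α f, hsm β g, kernelNormSq_toSignedMeasure_sub hk]
  simp only [integral_integral_gibbsKernel hC]
  rw [hswap]
  ring

end KernelNorm

end Sinkhorn

/-! ### Assembly of the primal and dual bounds. -/

theorem mainTheorem8 {X : Type*} [MetricSpace X] [CompactSpace X] [MeasurableSpace X]
    [BorelSpace X] (φ : ℝ≥0 → ℝ≥0∞) (hφ : Sinkhorn.IsEntropy φ) (C : X → X → ℝ)
    (hC : Continuous (Function.uncurry C)) (hCsymm : ∀ x y, C x y = C y x) (ε : ℝ) (hε : 0 < ε)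
    (α β : Measure X) [IsFiniteMeasure α] [IsFiniteMeasure β] (f g : C(X, ℝ))
    (hf : Sinkhorn.IsOptimalPotential φ C ε α f) (hg : Sinkhorn.IsOptimalPotential φ C ε β g) :
    (Sinkhorn.OT φ C ε α β ≠ ⊥ ∧
      (Sinkhorn.OT φ C ε α α ≠ ⊥ ∧ Sinkhorn.OT φ C ε α α ≠ ⊤) ∧
      (Sinkhorn.OT φ C ε β β ≠ ⊥ ∧ Sinkhorn.OT φ C ε β β ≠ ⊤)) ∧
    ((ε / 2 * Sinkhorn.kernelNormSq (Sinkhorn.gibbsKernel C ε)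
        (α.withDensityᵥ (fun x => Real.exp (f x / ε)) -
          β.withDensityᵥ (fun x => Real.exp (g x / ε))) : ℝ) : EReal) ≤
      Sinkhorn.sinkhornDiv φ C ε α β := by
  obtain ⟨hw, hwint⟩ := hf.conjugatePotential_spec hφ
  obtain ⟨hv, hvint⟩ := hg.conjugatePotential_spec hφ
  have hw' := hw.mono fun x hx => hx.le
  have hv' := hv.mono fun x hx => hx.le
  have hαβ := Sinkhorn.le_OT hC hε f g hwint hvint hw' hv'
  -- The self-cost lower bounds serve only to exclude `⊥`.
  have hαα := Sinkhorn.le_OT hC hε f f hwint hwint hw' hw'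
  have hββ := Sinkhorn.le_OT hC hε g g hvint hvint hv' hv'
  have hαα' := hf.OT_self_le hφ hC hCsymm hε
  have hββ' := hg.OT_self_le hφ hC hCsymm hε
  have bot_of_le : ∀ {r : ℝ} {x : EReal}, (r : EReal) ≤ x → x ≠ ⊥ := fun h =>
    ((EReal.bot_lt_coe _).trans_le h).ne'
  have top_of_le : ∀ {r : ℝ} {x : EReal}, x ≤ (r : EReal) → x ≠ ⊤ := fun h =>
    (h.trans_lt (EReal.coe_lt_top _)).ne
  refine ⟨⟨bot_of_le hαβ, ⟨bot_of_le hαα, top_of_le hαα'⟩, bot_of_le hββ, top_of_le hββ'⟩, ?_⟩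
  rw [Sinkhorn.kernelNormSq_gibbsKernel hC hCsymm, Sinkhorn.sinkhornDiv]
  have hsub : ∀ {x : EReal} {r : ℝ}, x ≤ (r : EReal) →
      ((1 / 2 : ℝ) : EReal) * x ≤ ((1 / 2 * r : ℝ) : EReal) := fun h => by
    rw [EReal.coe_mul]
    exact mul_le_mul_of_nonneg_left h (EReal.coe_nonneg.2 (by norm_num))
  refine le_trans ?_ (add_le_add_left
    (EReal.sub_le_sub (EReal.sub_le_sub hαβ (hsub hαα')) (hsub hββ')) _)
  rw [← EReal.coe_sub, ← EReal.coe_sub, ← EReal.coe_add, EReal.coe_le_coe_iff]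
  -- The two sides are equal after expansion: all losses occurred in the primal and dual bounds.
  nlinarith
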